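/- **Setting.** All measures on a Stone space are Radon Borel measures. For an algebra $\mathbb B$ of subsets of $\omega$ let $\mathrm{Stone}(\mathbb B)$ be the space of ultrafilters on $\mathbb B$, and for $A\in\mathbb B$ let $\widehat A=\{u : A\in u\}$ be the corresponding clopen set. Let $\mathfrak M$ be the algebra of Borel subsets of $[0,1]$ modulo Lebesgue null sets, $\lambda$ Lebesgue measure, $d$ asymptotic density on $\omega$, and $\mathcal Z$ the ideal of sets of density $0$. Fix a partition $\omega=\bigcup_n B_n$ into infinite sets $B_n=\{x^n_0<x^n_1<\cdots\}$; for $A\subseteq\omega$ put $A^n=\{x^n_i: i\in A\}$. Fix also $\varphi:\mathfrak M\to\mathcal P(\omega)$ such that $\varphi(M)$ has density $d(\varphi(M))=\lambda(M)$ for every $M\in\mathfrak M$, and such that $M\mapsto[\varphi(M)]_{\mathcal Z}$ is an injective Boolean homomorphism $\mathfrak M\to\mathcal P(\omega)/\mathcal Z$. For $1\le\alpha<\omega_1$ define an algebra $\mathbb B^{(\alpha)}$, a finitely additive measure $\mu^{(\alpha)}$ on it and a map $\varphi^{(\alpha)}:\mathfrak M\to\mathbb B^{(\alpha)}$ recursively.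 * $\mathbb B^{(1)}$ is generated by $\mathcal Z\cup\{\varphi(M):M\in\mathfrak M\}$, $\mu^{(1)}=d$ and $\varphi^{(1)}=\varphi$. * Given a sequence $(\mathbb B_n,\mu_n,\varphi_n)_n$ of such triples, the *canonical construction* gives $(\mathbb B,\mu,\psi)$ as follows. Put $\mathbb B_n^n=\{A^n:A\in\mathbb B_n\}$ and $\mu_n'(A)=\mu_n(\{i:x^n_i\in A\})$ for $A\in\mathbb B_n^n$. Then $\mathbb B$ is the algebra generated by all sets $A\subseteq\omega$ with $A\cap B_n\in\mathbb B_n^n$ for every $n$ and $\lim_n\mu_n'(A\cap B_n)=1$, together with all sets $\psi(M)=\bigcup_n\varphi_n(M)^n$, $M\in\mathfrak M$; and $\mu(A)=\lim_n\mu'_n(A\cap B_n)$ for $A\in\mathbb B$. * $(\mathbb B^{(\alpha+1)},\mu^{(\alpha+1)},\varphi^{(\alpha+1)})$ is the canonical construction from the constant sequence with value the triple of index $\alpha$. For a limit ordinal $\gamma<\omega_1$, the triple of index $\gamma$ is the canonical construction from triples of indices $\alpha_n$, where $(\alpha_n)_n$ is a strictly increasing sequence of ordinals $\geq 1$ cofinal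 in $\gamma$ (any choice is allowed). Fix $1\le\alpha<\omega_1$, let $K=K^{(\alpha)}=\mathrm{Stone}(\mathbb B^{(\alpha)})$, and let $\mu$ also denote the unique Radon measure on $K$ with $\mu(\widehat A)=\mu^{(\alpha)}(A)$ for all $A\in\mathbb B^{(\alpha)}$. Let $U=\bigcup_n\widehat{B_n}\subseteq K$ if $\alpha\ge2$, and $U=\bigcup_n\widehat{\{n\}}$ if $\alpha=1$. Let $P(K)$ be the set of Radon probability measures on $K$. For $\nu\in P(K)$ let $\nu^2$ be the non-atomic part of $\nu\restriction(K\setminus U)$, that is, what remains of $\nu\restriction (K\setminus U)$ after removing its point masses. Write $\nu\ll^*\mu$ if $\nu^2$ is absolutely continuous with respect to $\mu$. Call $\nu$ *non-atomic* if for every $\varepsilon>0$ there is a finite partition of $\omega$ into sets $A_i\in\mathbb B^{(\alpha)}$ with $\nu(\widehat{A_i})<\varepsilon$ for each $i$. **Theorem.** Let $(\nu_n)_n$ be a sequence in $P(K)$ with $\nu_n\ll^*\mu$ for every $n$. If $(\nu_n)_n$ converges weak$^*$ to a non-atomic $\nu\in P(K)$, i.e. $\int_K f\,d\nu_n\to\int_K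 f\,d\nu$ for every continuous $f:K\to\mathbb R$, then $\nu\ll^*\mu$. -/

import Mathlib

open Filter Topology MeasureTheory Set
open scoped Ordinal

/-! ### The Stone space of an algebra of subsets of `ℕ` -/

/-- An ultrafilter on the algebra of sets `𝔹`. -/
@[ext]
structure StonePoint (𝔹 : BooleanSubalgebra (Set ℕ)) where
  sets : Set (Set ℕ)
  sets_subset : ∀ A ∈ sets, A ∈ 𝔹
  univ_mem : Set.univ ∈ sets
  empty_notMem : ∅ ∉ sets
  superset_mem : ∀ A ∈ sets, ∀ C ∈ 𝔹, A ⊆ C → C ∈ sets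
  inter_mem : ∀ A ∈ sets, ∀ C ∈ sets, A ∩ C ∈ sets
  mem_or_compl_mem : ∀ A ∈ 𝔹, A ∈ sets ∨ Aᶜ ∈ sets

namespace StonePoint

variable {𝔹 : BooleanSubalgebra (Set ℕ)}

/-- The clopen subset of the Stone space corresponding to the element `A` of the algebra. -/
def hat (𝔹 : BooleanSubalgebra (Set ℕ)) (A : Set ℕ) : Set (StonePoint 𝔹) :=
  {u | A ∈ u.sets}

/-- The Stone topology. -/
instance : TopologicalSpace (StonePoint 𝔹) :=
  TopologicalSpace.generateFrom {U | ∃ A ∈ 𝔹, U = hat 𝔹 A}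

instance : MeasurableSpace (StonePoint 𝔹) := borel _

instance : BorelSpace (StonePoint 𝔹) := ⟨rfl⟩

end StonePoint

/-! ### The measure algebra of the unit interval and asymptotic density -/

/-- Two Borel subsets of the unit interval are identified if they differ by a null set. -/
def borelModNullSetoid : Setoid (Subtype (MeasurableSet : Set unitInterval → Prop)) where
  r M N := (M : Set unitInterval) =ᵐ[volume] (N : Set unitInterval)
  iseqv := ⟨fun _ => ae_eq_refl _, fun h => h.symm, fun h k => h.trans k⟩

/-- The measure algebra `𝔐`: Borel subsets of the unit interval modulo Lebesgue null sets. -/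
def MeasAlg : Type := Quotient borelModNullSetoid

/-- The class in `𝔐` of a Borel subset of the unit interval. -/
def MeasAlg.mk (M : Subtype (MeasurableSet : Set unitInterval → Prop)) : MeasAlg :=
  Quotient.mk borelModNullSetoid M

/-- `|A ∩ {0, …, n}| / (n + 1)`. -/
noncomputable def densityUpTo (A : Set ℕ) (n : ℕ) : ℝ :=
  ((A ∩ Set.Iic n).ncard : ℝ) / (n + 1)

/-- The set `A` has asymptotic density `d`. -/
def HasDensity (A : Set ℕ) (d : ℝ) : Prop :=
  Tendsto (densityUpTo A) atTop (𝓝 d)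

/-- Equality modulo the ideal of sets of asymptotic density zero. -/
def EqModDensityZero (A C : Set ℕ) : Prop :=
  HasDensity (symmDiff A C) 0

/-- `φ` assigns to every element `M` of `𝔐` a set of asymptotic density `λ(M)`, and induces an
injective homomorphism of Boolean algebras from `𝔐` to `𝒫(ℕ)` modulo density zero sets. -/
structure IsDensityLifting (φ : MeasAlg → Set ℕ) : Prop where
  inf : ∀ M N, EqModDensityZero (φ (.mk (M ⊓ N))) (φ (.mk M) ∩ φ (.mk N))
  compl : ∀ M, EqModDensityZero (φ (.mk Mᶜ)) (φ (.mk M))ᶜ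
  injective : ∀ M N, EqModDensityZero (φ M) (φ N) → M = N
  density : ∀ M, HasDensity (φ (.mk M)) ((volume : Measure unitInterval).real M)

/-! ### The recursive construction -/

/-- A partition of `ℕ` into infinite sets, indexed by `ℕ`. -/
structure IsInfinitePartition (B : ℕ → Set ℕ) : Prop where
  infinite : ∀ n, (B n).Infinite
  disjoint : Pairwise fun m n => Disjoint (B m) (B n)
  iUnion_eq : ⋃ n, B n = Set.univ

/-- The data produced at one step of the construction. -/
structure Stage where
  /-- the algebra of sets -/
  alg : BooleanSubalgebra (Set ℕ)
  /-- the finitely additive measure; only its values on `alg` matter -/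
  meas : Set ℕ → ℝ
  /-- the map witnessing that `(𝔐, λ)` is metrically isomorphic to `(alg, meas)` -/
  lift : MeasAlg → Set ℕ
  /-- the pieces (elements of `alg`) from which the stage is built -/
  brick : ℕ → Set ℕ

/-- The first stage: the algebra generated by the density zero sets and the sets `φ M`, with the
asymptotic density as measure, and the singletons as pieces. -/
noncomputable def firstStage (φ : MeasAlg → Set ℕ) : Stage where
  alg := BooleanSubalgebra.closure ({Z | HasDensity Z 0} ∪ Set.range φ)
  meas A := limUnder atTop (densityUpTo A)
  lift := φ
  brick n := {n}

/-- The copy `{x i : i ∈ A}` of `A` inside the infinite set `D = {x 0 < x 1 < ⋯}`. -/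
noncomputable def copyIn (D A : Set ℕ) : Set ℕ :=
  Nat.nth (· ∈ D) '' A

/-- The measure `μ` transported to the subsets of the infinite set `D = {x 0 < x 1 < ⋯}`: the
value at `A` is `μ {i | x i ∈ A}`. -/
noncomputable def transport (D : Set ℕ) (μ : Set ℕ → ℝ) (A : Set ℕ) : ℝ :=
  μ (Nat.nth (· ∈ D) ⁻¹' A)

/-- The sets whose traces on every `B n` belong to the copy of the `n`-th algebra, and have
measures converging to `1`. -/
def traceFilter (B : ℕ → Set ℕ) (P : ℕ → Stage) : Set (Set ℕ) :=
  {A | (∀ n, A ∩ B n ∈ copyIn (B n) '' ((P n).alg : Set (Set ℕ))) ∧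
    Tendsto (fun n => transport (B n) (P n).meas (A ∩ B n)) atTop (𝓝 1)}

/-- The union over `n` of the copies in `B n` of the sets assigned to `M` by the `n`-th stage. -/
noncomputable def unionLift (B : ℕ → Set ℕ) (P : ℕ → Stage) (M : MeasAlg) : Set ℕ :=
  ⋃ n, copyIn (B n) ((P n).lift M)

/-- The stage constructed canonically from a sequence of stages, the `n`-th being copied
into `B n`. -/
noncomputable def canonicalStage (B : ℕ → Set ℕ) (P : ℕ → Stage) : Stage where
  alg := BooleanSubalgebra.closure (traceFilter B P ∪ Set.range (unionLift B P))
  meas A := limUnder atTop fun n => transport (B n) (P n).meas (A ∩ B n)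
  lift := unionLift B P
  brick := B

/-- `IsStage B φ α P`: the stage `P` is obtained at step `α ≥ 1` of the transfinite recursion
started from `φ`. At a successor step all the stages used are the previous one; at a limit step `γ`
they belong to a strictly increasing sequence of ordinals cofinal in `γ`. -/
inductive IsStage (B : ℕ → Set ℕ) (φ : MeasAlg → Set ℕ) : Ordinal.{0} → Stage → Prop
  | one : IsStage B φ 1 (firstStage φ)
  | succ (α : Ordinal.{0}) (P : Stage) (hP : IsStage B φ α P) :
      IsStage B φ (Order.succ α) (canonicalStage B fun _ => P)
  | limit (γ : Ordinal.{0}) (hγ : Order.IsSuccLimit γ) (a : ℕ → Ordinal.{0})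
      (ha : StrictMono a) (ha_lt : ∀ n, a n < γ) (ha_cof : ∀ β < γ, ∃ n, β < a n)
      (P : ℕ → Stage) (hP : ∀ n, IsStage B φ (a n) (P n)) :
      IsStage B φ γ (canonicalStage B P)

/-- The space `K`: the Stone space of the algebra of the stage. -/
abbrev Stage.K (P : Stage) : Type := StonePoint P.alg

/-- `μ` is the Radon measure on `K` that extends the finitely additive measure of the stage. -/
def Stage.IsCanonicalMeasure (P : Stage) (μ : Measure P.K) : Prop :=
  μ.Regular ∧ ∀ A ∈ P.alg, μ (StonePoint.hat P.alg A) = ENNReal.ofReal (P.meas A)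

/-- The union, taken in `K`, of the clopen sets corresponding to the pieces. -/
def Stage.brickUnion (P : Stage) : Set P.K :=
  ⋃ n, StonePoint.hat P.alg (P.brick n)

/-! ### Measures on the Stone space -/

/-- A measure is non-atomic if there are finite partitions into members of the algebra all of
which have arbitrarily small measure. -/
def IsNonAtomic {𝔹 : BooleanSubalgebra (Set ℕ)} (ν : Measure (StonePoint 𝔹)) : Prop :=
  ∀ ε : ENNReal, 0 < ε → ∃ (k : ℕ) (A : Fin k → Set ℕ),
    (∀ i, A i ∈ 𝔹) ∧ (Pairwise fun i j => Disjoint (A i) (A j)) ∧ ⋃ i, A i = Set.univ ∧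
    ∀ i, ν (StonePoint.hat 𝔹 (A i)) < ε

/-- The non-atomic part of a finite Radon measure on a compact Hausdorff space: what is left after
removing the atomic part `∑ x, ρ {x} • δ_x`, i.e. the restriction of `ρ` to the (co-countable) set
of points of measure zero. -/
noncomputable def nonAtomicPart {X : Type*} [MeasurableSpace X] (ρ : Measure X) : Measure X :=
  ρ.restrict {x | ρ {x} = 0}

/-- `ν ≪* ρ`: the non-atomic part of the part of `ν` living off the union of the pieces is
absolutely continuous with respect to `ρ`. -/
def Stage.AlmostAbsolutelyContinuous (P : Stage) (ν ρ : Measure P.K) : Prop :=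
  nonAtomicPart (ν.restrict P.brickUnionᶜ) ≪ ρ

/-!
The proof has two parts.

**The algebras are closed under certain countable unions.** Every stage has the same shape
(`Stage.IsAsymptotic`): there are finitely additive probability measures `m j` on a larger algebra
`L`, namely the densities on initial segments for the first stage and the transported measures on the
`j`-th piece afterwards, such that the algebra of the stage consists of the sets in `L` which differ
from a lifted element of the measure algebra by a set whose measures `m j` tend to zero, and the
measure of the stage is `lim m j`. This shape is preserved by the canonical construction, hence holds
for all stages by induction (`IsStage.exists_isAsymptotic`). Since the measure algebra is
σ-complete, it follows that `⋃ k, C k` belongs to the algebra of the stage if each `C k` does, avoids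
the first `k` pieces and satisfies `m j (C k) ≤ 2⁻ᵏ` for all `j` (`Stage.IsAsymptotic.iUnion_mem`).

**A gliding hump.** If the limit measure `ν'` is not absolutely continuous off the pieces, it charges
a compact `μ`-null set disjoint from all pieces. Enlarging this set, one may take it to be the
intersection `G` of a decreasing sequence of clopen sets `hat (A k)`, where `A k` avoids the first `k`
pieces and `m j (A k) ≤ 2⁻ᵏ` (`Stage.IsAsymptotic.exists_neighbourhoods`). By assumption each `ν n`
is carried on `G` by countably many points, while `ν'` has no atoms, so that finitely many of these
points can be enclosed in a clopen set of small `ν'`-measure. For large `n`, a substantial part of the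
mass of `ν n` near `G` therefore sits on a clopen set nearly null for `ν'`
(`StonePoint.exists_hump`). Iterating this yields disjoint members `C k ⊆ A k` of the algebra and
indices `n k` with `ν (n k) (hat (C k))` bounded away from zero. All unions of subfamilies of the
`C k` lie in the algebra, so `S ↦ ν (n k) (hat (⋃ i ∈ S, C i))` is a sequence of finitely additive
measures on `𝒫(ℕ)` which converges on every set. This contradicts Rosenthal's disjointification lemma
(`exists_singleton_lt_of_tendsto`).
-/

/-! ### Finitely additive probability measures and convergence along a sequence of them -/

/-- `m` is a finitely additive probability measure on the algebra `L`; its values off `L` are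
irrelevant. -/
structure IsContent (L : BooleanSubalgebra (Set ℕ)) (m : Set ℕ → ℝ) : Prop where
  nonneg : ∀ A ∈ L, 0 ≤ m A
  union : ∀ A ∈ L, ∀ C ∈ L, Disjoint A C → m (A ∪ C) = m A + m C
  univ : m Set.univ = 1

lemma BooleanSubalgebra.symmDiff_mem {β : Type*} [BooleanAlgebra β] {L : BooleanSubalgebra β}
    {a b : β} (ha : a ∈ L) (hb : b ∈ L) : symmDiff a b ∈ L :=
  L.sup_mem (L.sdiff_mem ha hb) (L.sdiff_mem hb ha)

namespace IsContent

variable {L : BooleanSubalgebra (Set ℕ)} {m : Set ℕ → ℝ} {A C D E : Set ℕ}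

lemma empty (h : IsContent L m) : m ∅ = 0 := by
  have := h.union ∅ L.bot_mem ∅ L.bot_mem (by simp)
  simp only [Set.union_self] at this
  linarith

lemma diff_add_inter (h : IsContent L m) (hA : A ∈ L) (hC : C ∈ L) :
    m (A \ C) + m (A ∩ C) = m A := by
  have := h.union _ (L.sdiff_mem hA hC) (A ∩ C) (L.inf_mem hA hC) Set.disjoint_sdiff_inter
  rw [← this, Set.sdiff_union_inter]

lemma mono (h : IsContent L m) (hA : A ∈ L) (hC : C ∈ L) (hAC : A ⊆ C) : m A ≤ m C := by
  have h1 := h.diff_add_inter hC hA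
  rw [Set.inter_eq_self_of_subset_right hAC] at h1
  linarith [h.nonneg _ (L.sdiff_mem hC hA)]

lemma union_le (h : IsContent L m) (hA : A ∈ L) (hC : C ∈ L) : m (A ∪ C) ≤ m A + m C := by
  rw [← Set.union_sdiff_self, h.union _ hA _ (L.sdiff_mem hC hA) Set.disjoint_sdiff_right]
  linarith [h.mono (L.sdiff_mem hC hA) hC Set.sdiff_subset]

lemma le_add (h : IsContent L m) (hA : A ∈ L) (hC : C ∈ L) (hD : D ∈ L) (hs : A ⊆ C ∪ D) :
    m A ≤ m C + m D :=
  (h.mono hA (L.sup_mem hC hD) hs).trans (h.union_le hC hD)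

lemma le_add_three (h : IsContent L m) (hA : A ∈ L) (hC : C ∈ L) (hD : D ∈ L) (hE : E ∈ L)
    (hs : A ⊆ C ∪ D ∪ E) : m A ≤ m C + m D + m E :=
  (h.le_add hA (L.sup_mem hC hD) hE hs).trans (by gcongr; exact h.union_le hC hD)

lemma compl (h : IsContent L m) (hA : A ∈ L) : m Aᶜ = 1 - m A := by
  have := h.union A hA Aᶜ (L.compl_mem hA) disjoint_compl_right
  rw [Set.union_compl_self, h.univ] at this
  linarith

end IsContent

/-- The set `A` is null along the sequence `m`: its measures converge to zero. -/
def IsNullAlong (m : ℕ → Set ℕ → ℝ) (A : Set ℕ) : Prop :=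
  Tendsto (fun j => m j A) atTop (𝓝 0)

/-- A sequence of finitely additive probability measures on `L` together with a map `ψ` which is a
homomorphism modulo the sets null along the sequence, and transforms Lebesgue measure into the limit
of the sequence. -/
structure IsAsymptoticLift (L : BooleanSubalgebra (Set ℕ)) (m : ℕ → Set ℕ → ℝ)
    (ψ : MeasAlg → Set ℕ) : Prop where
  content : ∀ j, IsContent L (m j)
  mem : ∀ M, ψ M ∈ L
  inf : ∀ M N, IsNullAlong m (symmDiff (ψ (.mk (M ⊓ N))) (ψ (.mk M) ∩ ψ (.mk N)))
  compl : ∀ M, IsNullAlong m (symmDiff (ψ (.mk Mᶜ)) (ψ (.mk M))ᶜ)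
  tendsto : ∀ M, Tendsto (fun j => m j (ψ (.mk M))) atTop
    (𝓝 ((volume : Measure unitInterval).real M))

section Null

variable {L : BooleanSubalgebra (Set ℕ)} {m : ℕ → Set ℕ → ℝ} {A C D E : Set ℕ}

lemma IsNullAlong.of_subset_union (h : ∀ j, IsContent L (m j)) (hA : A ∈ L) (hC : C ∈ L)
    (hD : D ∈ L) (hs : A ⊆ C ∪ D) (hn : IsNullAlong m C) (hn' : IsNullAlong m D) :
    IsNullAlong m A :=
  squeeze_zero (fun j => (h j).nonneg A hA) (fun j => (h j).le_add hA hC hD hs)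
    (by simpa using Tendsto.add hn hn')

lemma IsNullAlong.trans (h : ∀ j, IsContent L (m j)) (hA : A ∈ L) (hC : C ∈ L) (hD : D ∈ L)
    (h1 : IsNullAlong m (symmDiff A C)) (h2 : IsNullAlong m (symmDiff C D)) :
    IsNullAlong m (symmDiff A D) :=
  .of_subset_union h (L.symmDiff_mem hA hD) (L.symmDiff_mem hA hC) (L.symmDiff_mem hC hD)
    (symmDiff_triangle A C D) h1 h2

lemma IsNullAlong.inter (h : ∀ j, IsContent L (m j)) (hA : A ∈ L) (hC : C ∈ L) (hD : D ∈ L)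
    (hE : E ∈ L) (h1 : IsNullAlong m (symmDiff A C)) (h2 : IsNullAlong m (symmDiff D E)) :
    IsNullAlong m (symmDiff (A ∩ D) (C ∩ E)) :=
  .of_subset_union h (L.symmDiff_mem (L.inf_mem hA hD) (L.inf_mem hC hE))
    (L.symmDiff_mem hA hC) (L.symmDiff_mem hD hE)
    (fun x hx => by simp only [mem_symmDiff, mem_inter_iff, mem_union] at hx ⊢; tauto) h1 h2

lemma abs_sub_le_symmDiff {m : Set ℕ → ℝ} (h : IsContent L m) (hA : A ∈ L) (hC : C ∈ L) :
    |m A - m C| ≤ m (symmDiff A C) := by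
  have hS := L.symmDiff_mem hA hC
  rw [abs_sub_le_iff]
  constructor
  · linarith [h.le_add hA hC hS fun x hx => by simp only [mem_symmDiff, mem_union]; tauto]
  · linarith [h.le_add hC hA hS fun x hx => by simp only [mem_symmDiff, mem_union]; tauto]

lemma IsNullAlong.tendsto (h : ∀ j, IsContent L (m j)) (hA : A ∈ L) (hC : C ∈ L)
    (hn : IsNullAlong m (symmDiff A C)) {a : ℝ} (ha : Tendsto (fun j => m j C) atTop (𝓝 a)) :
    Tendsto (fun j => m j A) atTop (𝓝 a) := by
  have : Tendsto (fun j => m j A - m j C) atTop (𝓝 0) :=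
    squeeze_zero_norm (fun j => abs_sub_le_symmDiff (h j) hA hC) hn
  simpa using this.add ha

end Null

namespace IsAsymptoticLift

variable {L : BooleanSubalgebra (Set ℕ)} {m : ℕ → Set ℕ → ℝ} {ψ : MeasAlg → Set ℕ}
  {A C : Set ℕ} {M N : Subtype (MeasurableSet : Set unitInterval → Prop)}

lemma null_compl (h : IsAsymptoticLift L m ψ) (hA : A ∈ L)
    (hn : IsNullAlong m (symmDiff A (ψ (.mk M)))) :
    IsNullAlong m (symmDiff Aᶜ (ψ (.mk Mᶜ))) := by
  refine .trans h.content (L.compl_mem hA) (L.compl_mem (h.mem (.mk M))) (h.mem _) ?_ ?_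
  · rwa [compl_symmDiff_compl]
  · rw [symmDiff_comm]
    exact h.compl M

lemma null_inter (h : IsAsymptoticLift L m ψ) (hA : A ∈ L) (hC : C ∈ L)
    (hn : IsNullAlong m (symmDiff A (ψ (.mk M)))) (hn' : IsNullAlong m (symmDiff C (ψ (.mk N)))) :
    IsNullAlong m (symmDiff (A ∩ C) (ψ (.mk (M ⊓ N)))) := by
  refine .trans h.content (L.inf_mem hA hC) (L.inf_mem (h.mem (.mk M)) (h.mem (.mk N))) (h.mem _)
    (.inter h.content hA (h.mem _) hC (h.mem _) hn hn') ?_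
  rw [symmDiff_comm]
  exact h.inf M N

lemma null_union (h : IsAsymptoticLift L m ψ) (hA : A ∈ L) (hC : C ∈ L)
    (hn : IsNullAlong m (symmDiff A (ψ (.mk M)))) (hn' : IsNullAlong m (symmDiff C (ψ (.mk N)))) :
    IsNullAlong m (symmDiff (A ∪ C) (ψ (.mk (M ⊔ N)))) := by
  have := h.null_compl (L.inf_mem (L.compl_mem hA) (L.compl_mem hC))
    (h.null_inter (L.compl_mem hA) (L.compl_mem hC) (h.null_compl hA hn) (h.null_compl hC hn'))
  have e : (Mᶜ ⊓ Nᶜ)ᶜ = M ⊔ N := by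
    rw [_root_.compl_inf, compl_compl, compl_compl]
  rw [e] at this
  convert this using 2
  change A ∪ C = (Aᶜ ∩ Cᶜ)ᶜ
  simp [Set.compl_inter]

lemma null_lift_bot (h : IsAsymptoticLift L m ψ) : IsNullAlong m (ψ (.mk ⊥)) := by
  have := h.tendsto ⊥
  simpa [IsNullAlong] using this

lemma null_iff_bot (h : IsAsymptoticLift L m ψ) (hA : A ∈ L) :
    IsNullAlong m A ↔ IsNullAlong m (symmDiff A (ψ (.mk ⊥))) := by
  constructor
  · intro hn
    exact .of_subset_union h.content (L.symmDiff_mem hA (h.mem _)) hA (h.mem _)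
      (fun x hx => by simp only [mem_symmDiff, mem_union] at hx ⊢; tauto) hn h.null_lift_bot
  · exact fun hn => .tendsto h.content hA (h.mem _) hn h.null_lift_bot

lemma null_symmDiff_self (h : IsAsymptoticLift L m ψ) (A : Set ℕ) :
    IsNullAlong m (symmDiff A A) := by
  have : ∀ j, m j ∅ = 0 := fun j => (h.content j).empty
  simp [IsNullAlong, this]

/-- The distance between `ψ M` and `ψ N` tends to the distance between `M` and `N`. -/
lemma tendsto_symmDiff (h : IsAsymptoticLift L m ψ)
    (M N : Subtype (MeasurableSet : Set unitInterval → Prop)) :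
    Tendsto (fun j => m j (symmDiff (ψ (.mk M)) (ψ (.mk N)))) atTop
      (𝓝 ((volume : Measure unitInterval).real (M \ N : Set unitInterval) +
        (volume : Measure unitInterval).real (N \ M : Set unitInterval))) := by
  have key : ∀ M N : Subtype (MeasurableSet : Set unitInterval → Prop),
      Tendsto (fun j => m j (ψ (.mk M) \ ψ (.mk N))) atTop
        (𝓝 ((volume : Measure unitInterval).real (M \ N : Set unitInterval))) := fun M N =>
    IsNullAlong.tendsto h.content (L.sdiff_mem (h.mem _) (h.mem _)) (h.mem _)
      (h.null_inter (h.mem _) (L.compl_mem (h.mem _)) (h.null_symmDiff_self _)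
        (h.null_compl (h.mem _) (h.null_symmDiff_self _)))
      (by simpa [Set.sdiff_eq] using h.tendsto (M ⊓ Nᶜ))
  refine ((key M N).add (key N M)).congr fun j => ?_
  exact ((h.content j).union _ (L.sdiff_mem (h.mem _) (h.mem _)) _
    (L.sdiff_mem (h.mem _) (h.mem _)) disjoint_sdiff_sdiff).symm

/-- The algebra of the elements of `L` which are equal to a set `ψ M` up to a set null along `m`. -/
def algebra (h : IsAsymptoticLift L m ψ) : BooleanSubalgebra (Set ℕ) where
  carrier := {A | A ∈ L ∧ ∃ M, IsNullAlong m (symmDiff A (ψ (.mk M)))}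
  supClosed' := by
    rintro A ⟨hA, M, hM⟩ C ⟨hC, N, hN⟩
    exact ⟨L.sup_mem hA hC, _, h.null_union hA hC hM hN⟩
  infClosed' := by
    rintro A ⟨hA, M, hM⟩ C ⟨hC, N, hN⟩
    exact ⟨L.inf_mem hA hC, _, h.null_inter hA hC hM hN⟩
  compl_mem' := by
    rintro A ⟨hA, M, hM⟩
    exact ⟨L.compl_mem hA, _, h.null_compl hA hM⟩
  bot_mem' := by
    refine ⟨L.bot_mem, ⊥, (h.null_iff_bot L.bot_mem).1 ?_⟩
    have : ∀ j, m j ∅ = 0 := fun j => (h.content j).empty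
    simp [IsNullAlong, this]

lemma lift_mem_algebra (h : IsAsymptoticLift L m ψ) (M : MeasAlg) : ψ M ∈ h.algebra := by
  obtain ⟨M, rfl⟩ := Quotient.exists_rep M
  exact ⟨h.mem _, M, h.null_symmDiff_self _⟩

/-- A family of members of the algebra, together with the range of `ψ`, generates the algebra as soon
as it generates the null sets. -/
lemma closure_eq_algebra (h : IsAsymptoticLift L m ψ) {G : Set (Set ℕ)}
    (hG : G ⊆ h.algebra) (hnull : ∀ Z ∈ L, IsNullAlong m Z →
      Z ∈ BooleanSubalgebra.closure (G ∪ range ψ)) :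
    BooleanSubalgebra.closure (G ∪ range ψ) = h.algebra := by
  refine le_antisymm (BooleanSubalgebra.closure_le.2 (union_subset hG ?_)) ?_
  · rintro _ ⟨M, rfl⟩
    exact h.lift_mem_algebra M
  · rintro A ⟨hA, M, hM⟩
    have h1 := hnull _ (L.symmDiff_mem hA (h.mem _)) hM
    have h2 : ψ (.mk M) ∈ BooleanSubalgebra.closure (G ∪ range ψ) :=
      BooleanSubalgebra.mem_closure_of_mem (Or.inr ⟨_, rfl⟩)
    simpa using BooleanSubalgebra.symmDiff_mem h1 h2

/-- Along the sequence, every member of the algebra has a limit measure. -/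
lemma exists_tendsto (h : IsAsymptoticLift L m ψ) (hA : A ∈ h.algebra) :
    ∃ a, Tendsto (fun j => m j A) atTop (𝓝 a) := by
  obtain ⟨hL, M, hM⟩ := hA
  exact ⟨_, IsNullAlong.tendsto h.content hL (h.mem _) hM (h.tendsto M)⟩

end IsAsymptoticLift

/-! ### The stages of the construction -/

namespace Stage

/-- The map `lift` is a measure preserving homomorphism from the measure algebra to the algebra of
the stage modulo sets of measure zero. -/
structure IsLifted (P : Stage) : Prop where
  content : IsContent P.alg P.meas
  mem : ∀ M, P.lift M ∈ P.alg
  inf : ∀ M N, P.meas (symmDiff (P.lift (.mk (M ⊓ N))) (P.lift (.mk M) ∩ P.lift (.mk N))) = 0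
  compl : ∀ M, P.meas (symmDiff (P.lift (.mk Mᶜ)) (P.lift (.mk M))ᶜ) = 0
  meas_lift : ∀ M, P.meas (P.lift (.mk M)) = (volume : Measure unitInterval).real M

/-- The common shape of all stages: the algebra consists of the members of `L` which are, up to sets
null along the sequence `m`, in the range of the lifting, and the measure is the limit of the
sequence `m`. The algebra `L` is determined by traces on the pieces, and `m j` does not charge sets
disjoint from the pieces up to the `j`-th. -/
structure IsAsymptotic (P : Stage) (L : BooleanSubalgebra (Set ℕ)) (m : ℕ → Set ℕ → ℝ) :
    Prop where
  isLift : IsAsymptoticLift L m P.lift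
  alg_eq : P.alg = isLift.algebra
  tendsto_meas : ∀ A ∈ P.alg, Tendsto (fun j => m j A) atTop (𝓝 (P.meas A))
  brick_mem : ∀ n, P.brick n ∈ L
  brick_null : ∀ n, IsNullAlong m (P.brick n)
  glue : ∀ A, (∀ n, A ∩ P.brick n ∈ L) → A ∈ L
  eq_zero : ∀ j, ∀ A ∈ L, (∀ i ≤ j, Disjoint A (P.brick i)) → m j A = 0

lemma IsAsymptotic.le {P : Stage} {L : BooleanSubalgebra (Set ℕ)} {m : ℕ → Set ℕ → ℝ}
    (h : P.IsAsymptotic L m) {A : Set ℕ} (hA : A ∈ P.alg) : A ∈ L := by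
  rw [h.alg_eq] at hA
  exact hA.1

lemma IsAsymptotic.brick_mem_alg {P : Stage} {L : BooleanSubalgebra (Set ℕ)} {m : ℕ → Set ℕ → ℝ}
    (h : P.IsAsymptotic L m) (n : ℕ) : P.brick n ∈ P.alg := by
  rw [h.alg_eq]
  exact ⟨h.brick_mem n, ⊥, (h.isLift.null_iff_bot (h.brick_mem n)).1 (h.brick_null n)⟩

lemma IsAsymptotic.lift_mem_alg {P : Stage} {L : BooleanSubalgebra (Set ℕ)} {m : ℕ → Set ℕ → ℝ}
    (h : P.IsAsymptotic L m) (M : MeasAlg) : P.lift M ∈ P.alg := by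
  rw [h.alg_eq]
  exact h.isLift.lift_mem_algebra M

lemma IsAsymptotic.isLifted {P : Stage} {L : BooleanSubalgebra (Set ℕ)} {m : ℕ → Set ℕ → ℝ}
    (h : P.IsAsymptotic L m) : P.IsLifted where
  content :=
    { nonneg := fun A hA => ge_of_tendsto' (h.tendsto_meas A hA)
        fun j => (h.isLift.content j).nonneg A (h.le hA)
      union := fun A hA C hC hd => by
        refine tendsto_nhds_unique (h.tendsto_meas _ (P.alg.sup_mem hA hC)) ?_
        refine ((h.tendsto_meas A hA).add (h.tendsto_meas C hC)).congr fun j => ?_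
        exact ((h.isLift.content j).union _ (h.le hA) _ (h.le hC) hd).symm
      univ := by
        refine tendsto_nhds_unique (h.tendsto_meas _ P.alg.top_mem) ?_
        refine tendsto_const_nhds.congr fun j => (h.isLift.content j).univ.symm }
  mem := h.lift_mem_alg
  inf M N := by
    exact tendsto_nhds_unique (h.tendsto_meas _ (P.alg.symmDiff_mem (h.lift_mem_alg _)
      (P.alg.inf_mem (h.lift_mem_alg _) (h.lift_mem_alg _)))) (h.isLift.inf M N)
  compl M := by
    exact tendsto_nhds_unique (h.tendsto_meas _
      (P.alg.symmDiff_mem (h.lift_mem_alg _) (P.alg.compl_mem (h.lift_mem_alg _)))) (h.isLift.compl M)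
  meas_lift M := tendsto_nhds_unique (h.tendsto_meas _ (h.lift_mem_alg _)) (h.isLift.tendsto M)

end Stage

/-! #### The first stage -/

lemma isContent_densityUpTo (j : ℕ) : IsContent ⊤ fun A => densityUpTo A j where
  nonneg A _ := by unfold densityUpTo; positivity
  union A _ C _ hd := by
    have hf : ∀ A : Set ℕ, (A ∩ Iic j).Finite := fun A => (finite_Iic j).inter_of_right A
    unfold densityUpTo
    rw [Set.union_inter_distrib_right, Set.ncard_union_eq
      (hd.mono inter_subset_left inter_subset_left) (hf A) (hf C)]
    push_cast
    ring
  univ := by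
    have : (Set.Iic j).ncard = j + 1 := by
      rw [← Finset.coe_Iic, Set.ncard_coe_finset]; simp
    unfold densityUpTo
    rw [Set.univ_inter, this]
    push_cast
    field_simp

lemma IsDensityLifting.isAsymptotic {φ : MeasAlg → Set ℕ} (h : IsDensityLifting φ) :
    (firstStage φ).IsAsymptotic ⊤ fun j A => densityUpTo A j := by
  have hl : IsAsymptoticLift ⊤ (fun j A => densityUpTo A j) φ :=
    { content := isContent_densityUpTo
      mem := fun _ => BooleanSubalgebra.mem_top
      inf := h.inf
      compl := h.compl
      tendsto := h.density }
  have ha : (firstStage φ).alg = hl.algebra := by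
    refine hl.closure_eq_algebra ?_ fun Z _ hZ =>
      BooleanSubalgebra.mem_closure_of_mem (Or.inl hZ)
    exact fun Z hZ => ⟨BooleanSubalgebra.mem_top, ⊥,
      (hl.null_iff_bot BooleanSubalgebra.mem_top).1 hZ⟩
  exact
    { isLift := hl
      alg_eq := ha
      tendsto_meas := fun A hA => by
        rw [ha] at hA
        exact tendsto_nhds_limUnder (hl.exists_tendsto hA)
      brick_mem := fun _ => BooleanSubalgebra.mem_top
      brick_null := fun n => by
        refine squeeze_zero (fun j => (isContent_densityUpTo j).nonneg _ BooleanSubalgebra.mem_top)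
          (fun j => ?_) tendsto_one_div_add_atTop_nhds_zero_nat
        have : (({n} : Set ℕ) ∩ Iic j).ncard ≤ 1 :=
          (Set.ncard_le_ncard inter_subset_left (finite_singleton n)).trans (ncard_singleton n).le
        have : ((({n} : Set ℕ) ∩ Iic j).ncard : ℝ) ≤ 1 := by exact_mod_cast this
        change ((({n} : Set ℕ) ∩ Iic j).ncard : ℝ) / (j + 1) ≤ 1 / (j + 1)
        gcongr
      glue := fun _ _ => BooleanSubalgebra.mem_top
      eq_zero := fun j A _ hd => by
        have : A ∩ Iic j = ∅ := by
          ext i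
          simp only [mem_inter_iff, mem_Iic, mem_empty_iff_false, iff_false, not_and]
          exact fun hi hij => disjoint_singleton_right.1 (hd i hij) hi
        change ((A ∩ Iic j).ncard : ℝ) / (j + 1) = 0
        simp [this] }

/-! #### The canonical construction -/

section Canonical

variable {B : ℕ → Set ℕ} {Q : ℕ → Stage}

lemma range_nth_mem {D : Set ℕ} (hD : D.Infinite) : range (Nat.nth (· ∈ D)) = D :=
  Nat.range_nth_of_infinite hD

lemma preimage_copyIn {D : Set ℕ} (hD : D.Infinite) (A : Set ℕ) :
    Nat.nth (· ∈ D) ⁻¹' copyIn D A = A :=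
  Set.preimage_image_eq _ (Nat.nth_injective hD)

lemma copyIn_subset {D : Set ℕ} (hD : D.Infinite) (A : Set ℕ) : copyIn D A ⊆ D :=
  (image_subset_range _ _).trans (range_nth_mem hD).subset

lemma preimage_inter_self {D : Set ℕ} (hD : D.Infinite) (A : Set ℕ) :
    Nat.nth (· ∈ D) ⁻¹' (A ∩ D) = Nat.nth (· ∈ D) ⁻¹' A := by
  ext i
  have : Nat.nth (· ∈ D) i ∈ D := (range_nth_mem hD).subset ⟨i, rfl⟩
  simp [this]

lemma preimage_eq_empty {D A : Set ℕ} (hD : D.Infinite) (h : Disjoint A D) :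
    Nat.nth (· ∈ D) ⁻¹' A = ∅ := by
  rw [← preimage_inter_self hD, h.inter_eq, Set.preimage_empty]

lemma inter_mem_copyIn_iff {D A : Set ℕ} (hD : D.Infinite) (R : BooleanSubalgebra (Set ℕ)) :
    A ∩ D ∈ copyIn D '' (R : Set (Set ℕ)) ↔ Nat.nth (· ∈ D) ⁻¹' A ∈ R := by
  constructor
  · rintro ⟨C, hC, h⟩
    rw [← preimage_inter_self hD, ← h, preimage_copyIn hD]
    exact hC
  · refine fun h => ⟨_, h, ?_⟩
    rw [copyIn, Set.image_preimage_eq_inter_range, range_nth_mem hD]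

lemma preimage_unionLift (hB : IsInfinitePartition B) (j : ℕ) (M : MeasAlg) :
    Nat.nth (· ∈ B j) ⁻¹' unionLift B Q M = (Q j).lift M := by
  rw [← preimage_inter_self (hB.infinite j)]
  have : unionLift B Q M ∩ B j = copyIn (B j) ((Q j).lift M) := by
    apply Set.Subset.antisymm
    · rintro x ⟨hx, hxj⟩
      obtain ⟨n, hn⟩ := mem_iUnion.1 hx
      obtain rfl : n = j := by
        by_contra hne
        exact (hB.disjoint hne).le_bot ⟨copyIn_subset (hB.infinite n) _ hn, hxj⟩
      exact hn
    · exact fun x hx => ⟨mem_iUnion.2 ⟨j, hx⟩, copyIn_subset (hB.infinite j) _ hx⟩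
  rw [this, preimage_copyIn (hB.infinite j)]

/-- The sets all of whose traces on the `B n` belong to the copies of the given algebras. -/
def traceAlgebra (B : ℕ → Set ℕ) (Q : ℕ → Stage) : BooleanSubalgebra (Set ℕ) where
  carrier := {A | ∀ n, Nat.nth (· ∈ B n) ⁻¹' A ∈ (Q n).alg}
  supClosed' _ hA _ hC n := (Q n).alg.sup_mem (hA n) (hC n)
  infClosed' _ hA _ hC n := (Q n).alg.inf_mem (hA n) (hC n)
  compl_mem' hA n := (Q n).alg.compl_mem (hA n)
  bot_mem' n := (Q n).alg.bot_mem

/-- The canonical construction only needs its ingredients up to sets of measure zero: the lifting laws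
which hold modulo measure zero in each `Q n` hold modulo null sets along the sequence. -/
lemma isAsymptotic_canonicalStage (hB : IsInfinitePartition B) (hQ : ∀ n, (Q n).IsLifted) :
    (canonicalStage B Q).IsAsymptotic (traceAlgebra B Q)
      fun j A => transport (B j) (Q j).meas (A ∩ B j) := by
  have ht : ∀ j A, transport (B j) (Q j).meas (A ∩ B j) =
      (Q j).meas (Nat.nth (· ∈ B j) ⁻¹' A) := fun j A => by
    rw [transport, preimage_inter_self (hB.infinite j)]
  have hl : IsAsymptoticLift (traceAlgebra B Q)
      (fun j A => transport (B j) (Q j).meas (A ∩ B j)) (unionLift B Q) :=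
    { content := fun j =>
        { nonneg := fun A hA => by
            rw [ht]
            exact (hQ j).content.nonneg _ (hA j)
          union := fun A hA C hC hd => by
            rw [ht, ht, ht, Set.preimage_union]
            exact (hQ j).content.union _ (hA j) _ (hC j) (hd.preimage _)
          univ := by
            rw [ht, Set.preimage_univ]
            exact (hQ j).content.univ }
      mem := fun M n => by
        rw [preimage_unionLift hB]
        exact (hQ n).mem M
      inf := fun M N => by
        refine tendsto_const_nhds.congr fun j => ?_
        beta_reduce
        rw [ht, Set.preimage_symmDiff, Set.preimage_inter]
        simp only [preimage_unionLift hB]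
        exact ((hQ j).inf M N).symm
      compl := fun M => by
        refine tendsto_const_nhds.congr fun j => ?_
        beta_reduce
        rw [ht, Set.preimage_symmDiff, Set.preimage_compl]
        simp only [preimage_unionLift hB]
        exact ((hQ j).compl M).symm
      tendsto := fun M => by
        refine tendsto_const_nhds.congr fun j => ?_
        rw [ht, preimage_unionLift hB]
        exact ((hQ j).meas_lift M).symm }
  have hf : ∀ A, A ∈ traceFilter B Q ↔ A ∈ traceAlgebra B Q ∧
      Tendsto (fun j => transport (B j) (Q j).meas (A ∩ B j)) atTop (𝓝 1) := fun A => by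
    refine and_congr_left fun _ => forall_congr' fun n => ?_
    exact inter_mem_copyIn_iff (hB.infinite n) _
  have hnull : ∀ A ∈ traceAlgebra B Q, A ∈ traceFilter B Q ↔
      IsNullAlong (fun j A => transport (B j) (Q j).meas (A ∩ B j)) Aᶜ := fun A hA => by
    rw [hf, IsNullAlong, and_iff_right hA]
    simp only [(hl.content _).compl hA]
    refine ⟨fun h => by simpa using h.const_sub 1, fun h => by simpa using h.const_sub 1⟩
  have ha : (canonicalStage B Q).alg = hl.algebra := by
    refine hl.closure_eq_algebra (fun A hA => ?_) fun Z hZ hn => ?_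
    · have hA' := ((hf A).1 hA).1
      have : Aᶜ ∈ hl.algebra := ⟨(traceAlgebra B Q).compl_mem hA', ⊥,
        (hl.null_iff_bot ((traceAlgebra B Q).compl_mem hA')).1 ((hnull A hA').1 hA)⟩
      exact BooleanSubalgebra.compl_mem_iff.1 this
    · refine BooleanSubalgebra.compl_mem_iff.1 (BooleanSubalgebra.mem_closure_of_mem (Or.inl ?_))
      exact (hnull _ ((traceAlgebra B Q).compl_mem hZ)).2 (by simpa using hn)
  exact
    { isLift := hl
      alg_eq := ha
      tendsto_meas := fun A hA => by
        rw [ha] at hA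
        exact tendsto_nhds_limUnder (hl.exists_tendsto hA)
      brick_mem := fun n j => by
        change Nat.nth (· ∈ B j) ⁻¹' B n ∈ (Q j).alg
        rcases eq_or_ne n j with rfl | hne
        · have := preimage_inter_self (hB.infinite n) Set.univ
          rw [Set.univ_inter, Set.preimage_univ] at this
          rw [this]
          exact (Q n).alg.top_mem
        · rw [preimage_eq_empty (hB.infinite j) (hB.disjoint hne)]
          exact (Q j).alg.bot_mem
      brick_null := fun n => by
        refine tendsto_const_nhds.congr' ?_
        filter_upwards [eventually_gt_atTop n] with j hj
        rw [ht]
        change 0 = (Q j).meas (Nat.nth (· ∈ B j) ⁻¹' B n)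
        rw [preimage_eq_empty (hB.infinite j) (hB.disjoint hj.ne), (hQ j).content.empty]
      glue := fun A hA n => by
        have := hA n n
        rwa [show (canonicalStage B Q).brick n = B n from rfl,
          preimage_inter_self (hB.infinite n)] at this
      eq_zero := fun j A _ hd => by
        rw [ht, preimage_eq_empty (hB.infinite j) (hd j le_rfl), (hQ j).content.empty] }

end Canonical

/-! #### Transfinite induction over the stages -/

lemma IsStage.exists_isAsymptotic {B : ℕ → Set ℕ} (hB : IsInfinitePartition B)
    {φ : MeasAlg → Set ℕ} (hφ : IsDensityLifting φ) {α : Ordinal.{0}} {P : Stage}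
    (hP : IsStage B φ α P) : ∃ L m, P.IsAsymptotic L m := by
  induction hP with
  | one => exact ⟨_, _, hφ.isAsymptotic⟩
  | succ α P _ ih =>
    obtain ⟨L, m, h⟩ := ih
    exact ⟨_, _, isAsymptotic_canonicalStage hB fun _ => h.isLifted⟩
  | limit γ _ a _ _ _ P _ ih =>
    refine ⟨_, _, isAsymptotic_canonicalStage hB fun n => ?_⟩
    obtain ⟨L, m, h⟩ := ih n
    exact h.isLifted

/-! ### Unions of sequences with summable measures -/

/-- The algebra of a stage contains the union of a sequence `C` of its members if `C k` avoids the
first `k` pieces and has measure at most `2⁻ᵏ` uniformly along the sequence `m`: if `C k` agrees with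
the lifting of `M k` up to a null set, then `⋃ k, C k` agrees with the lifting of `⋃ k, M k`. -/
lemma Stage.IsAsymptotic.iUnion_mem {P : Stage} {L : BooleanSubalgebra (Set ℕ)}
    {m : ℕ → Set ℕ → ℝ} (h : P.IsAsymptotic L m) {C : ℕ → Set ℕ} (hC : ∀ k, C k ∈ P.alg)
    (hd : ∀ k, ∀ j < k, Disjoint (C k) (P.brick j)) (hm : ∀ k j, m j (C k) ≤ (1 / 2) ^ k) :
    (⋃ k, C k) ∈ P.alg := by
  have hCL : ∀ k, C k ∈ L := fun k => h.le (hC k)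
  have hcont := h.isLift.content
  set T : ℕ → Set ℕ := fun K => ⋃ k ≥ K, C k with hT
  have hTsucc : ∀ K, T K = C K ∪ T (K + 1) := fun K => by
    ext x
    simp only [hT, mem_iUnion, mem_union, exists_prop]
    constructor
    · rintro ⟨k, hk, hx⟩
      rcases eq_or_lt_of_le hk with rfl | hk
      · exact Or.inl hx
      · exact Or.inr ⟨k, hk, hx⟩
    · rintro (hx | ⟨k, hk, hx⟩)
      · exact ⟨K, le_rfl, hx⟩
      · exact ⟨k, by omega, hx⟩
  have hTdisj : ∀ K, ∀ j < K, Disjoint (T K) (P.brick j) := fun K j hj => by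
    simp only [hT, disjoint_iUnion_left]
    exact fun k hk => hd k j (hj.trans_le hk)
  have hTL : ∀ K, T K ∈ L := fun K => by
    refine h.glue _ fun n => ?_
    have : ∀ d K, n + 1 ≤ K + d → T K ∩ P.brick n ∈ L := fun d => by
      induction d with
      | zero =>
        intro K hK
        rw [(hTdisj K n (by omega)).inter_eq]
        exact L.bot_mem
      | succ d ih =>
        intro K hK
        rw [hTsucc, Set.union_inter_distrib_right]
        exact L.sup_mem (L.inf_mem (hCL K) (h.brick_mem n)) (ih (K + 1) (by omega))
    exact this (n + 1) K (by omega)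
  -- Only the terms `C k` with `k ≤ j` contribute to `m j (T K)`.
  have hTm : ∀ j K, m j (T K) ≤ 2 * (1 / 2) ^ K := fun j K => by
    have : ∀ d K, j + 1 ≤ K + d → m j (T K) ≤ 2 * (1 / 2) ^ K := fun d => by
      induction d with
      | zero =>
        intro K hK
        rw [h.eq_zero j _ (hTL K) fun i hi => hTdisj K i (by omega)]
        positivity
      | succ d ih =>
        intro K hK
        have h1 := (hcont j).le_add (hTL K) (hCL K) (hTL (K + 1)) (hTsucc K).subset
        have h2 := ih (K + 1) (by omega)
        rw [pow_succ] at h2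
        linarith [hm K j]
    exact this (j + 1) K (by omega)
  have hC' : ∀ k, ∃ M, IsNullAlong m (symmDiff (C k) (P.lift (.mk M))) := fun k => by
    have := hC k
    rw [h.alg_eq] at this
    exact this.2
  choose M hM using hC'
  let N : ℕ → Subtype (MeasurableSet : Set unitInterval → Prop) := fun K =>
    ⟨⋃ k < K, (M k : Set unitInterval), .biUnion (to_countable _) fun k _ => (M k).2⟩
  let N' : Subtype (MeasurableSet : Set unitInterval → Prop) :=
    ⟨⋃ k, (M k : Set unitInterval), .iUnion fun k => (M k).2⟩
  have hHL : ∀ K, (⋃ k < K, C k) ∈ L := fun K => by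
    induction K with
    | zero => simpa using L.bot_mem
    | succ K ih =>
      rw [Set.biUnion_lt_succ]
      exact L.sup_mem ih (hCL K)
  have hH : ∀ K, IsNullAlong m (symmDiff (⋃ k < K, C k) (P.lift (.mk (N K)))) := fun K => by
    induction K with
    | zero =>
      have : N 0 = ⊥ := Subtype.ext (by simp [N])
      rw [this]
      refine (h.isLift.null_iff_bot (hHL 0)).1 ?_
      simp [IsNullAlong, (hcont _).empty]
    | succ K ih =>
      have : N (K + 1) = N K ⊔ M K := Subtype.ext (Set.biUnion_lt_succ _ _)
      rw [this, Set.biUnion_lt_succ]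
      exact h.isLift.null_union (hHL K) (hCL K) ih (hM K)
  have hUL : (⋃ k, C k) ∈ L := by
    have : (⋃ k, C k) = T 0 := by simp [hT]
    rw [this]
    exact hTL 0
  have hN : Tendsto (fun K => (volume : Measure unitInterval).real
      (N' \ N K : Set unitInterval)) atTop (𝓝 0) := by
    have hanti : Antitone fun K => (N' \ N K : Set unitInterval) := fun a b hab =>
      sdiff_subset_sdiff_right (biUnion_mono (fun k hk => lt_of_lt_of_le hk hab) fun _ _ => le_rfl)
    have hempty : ⋂ K, (N' \ N K : Set unitInterval) = ∅ := by
      ext x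
      simp only [mem_iInter, mem_empty_iff_false, iff_false, not_forall]
      by_cases hx : x ∈ (N' : Set unitInterval)
      · obtain ⟨k, hk⟩ := mem_iUnion.1 hx
        refine ⟨k + 1, fun hx' => hx'.2 ?_⟩
        exact mem_iUnion₂.2 ⟨k, k.lt_succ_self, hk⟩
      · exact ⟨0, fun h => hx h.1⟩
    have := tendsto_measure_iInter_atTop (μ := (volume : Measure unitInterval))
      (fun K => (N'.2.diff (N K).2).nullMeasurableSet) hanti ⟨0, measure_ne_top _ _⟩
    rw [hempty, measure_empty] at this
    exact (ENNReal.tendsto_toReal_zero_iff fun _ => measure_ne_top _ _).2 this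
  rw [h.alg_eq]
  refine ⟨hUL, N', ?_⟩
  -- Compare `⋃ k, C k` with `⋃ k < K, C k`, then with the lifting of `N K`, then with that of `N'`.
  rw [IsNullAlong, Metric.tendsto_atTop']
  intro ε hε
  have hgeo : Tendsto (fun K : ℕ => 2 * (1 / 2 : ℝ) ^ K) atTop (𝓝 0) := by
    simpa using (tendsto_pow_atTop_nhds_zero_of_lt_one (r := (1 / 2 : ℝ)) (by norm_num)
      (by norm_num)).const_mul 2
  obtain ⟨K, hK1, hK2⟩ := ((hgeo.eventually_lt_const (show (0 : ℝ) < ε / 3 by linarith)).and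
    (hN.eventually_lt_const (show (0 : ℝ) < ε / 3 by linarith))).exists
  have hlt := h.isLift.tendsto_symmDiff (N K) N'
  have hsub : (N K \ N' : Set unitInterval) = ∅ :=
    sdiff_eq_empty.2 (iUnion₂_subset fun k _ => subset_iUnion (fun k => (M k : Set unitInterval)) k)
  rw [hsub, measureReal_empty, zero_add] at hlt
  have hev := ((hH K).eventually_lt_const (show (0 : ℝ) < ε / 3 by linarith)).and
    (hlt.eventually_lt_const hK2)
  obtain ⟨J, hJ⟩ := eventually_atTop.1 hev
  refine ⟨J, fun j hj => ?_⟩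
  obtain ⟨h1, h2⟩ := hJ j hj.le
  have hmem : ∀ {A}, A ∈ L → ∀ M, symmDiff A (P.lift M) ∈ L := fun hA M =>
    L.symmDiff_mem hA (h.isLift.mem M)
  have hsplit : (⋃ k, C k) = (⋃ k < K, C k) ∪ T K := by
    ext x
    simp only [hT, mem_iUnion, mem_union, exists_prop]
    constructor
    · rintro ⟨k, hx⟩
      exact (lt_or_ge k K).imp (fun hk => ⟨k, hk, hx⟩) fun hk => ⟨k, hk, hx⟩
    · rintro (⟨k, _, hx⟩ | ⟨k, _, hx⟩) <;> exact ⟨k, hx⟩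
  have h3 := (hcont j).le_add_three (hmem hUL (.mk N')) (hmem (hHL K) (.mk (N K)))
    (hmem (h.isLift.mem (.mk (N K))) (.mk N')) (hTL K) (by
      rw [hsplit]
      intro x hx
      simp only [mem_symmDiff, mem_union] at hx ⊢
      tauto)
  rw [Real.dist_eq, sub_zero, abs_of_nonneg ((hcont j).nonneg _ (hmem hUL _))]
  linarith [hTm j K]

/-! ### Rosenthal's lemma for sequences of finitely additive measures -/

section Rosenthal

variable {f : ℕ → Set ℕ → ℝ}

/-- Rosenthal's disjointification lemma, for uniformly bounded nonnegative finitely additive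
measures on `𝒫(ℕ)`. -/
lemma exists_infinite_forall_diff_singleton_lt (h0 : ∀ k S, 0 ≤ f k S)
    (hadd : ∀ k S T, Disjoint S T → f k (S ∪ T) = f k S + f k T) {b : ℝ}
    (hb : ∀ k, f k univ ≤ b) {ε : ℝ} (hε : 0 < ε) :
    ∃ S : Set ℕ, S.Infinite ∧ ∀ k ∈ S, f k (S \ {k}) < ε := by
  have hmono : ∀ k S T, S ⊆ T → f k S ≤ f k T := fun k S T h => by
    have := hadd k S (T \ S) disjoint_sdiff_right
    rw [Set.union_sdiff_cancel h] at this
    linarith [h0 k (T \ S)]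
  -- If no piece of a partition of `R` into infinitely many infinite sets works, then the witnesses
  -- of this failure form an infinite set on which the bound has dropped by `ε`.
  have key : ∀ n : ℕ, ∀ R : Set ℕ, R.Infinite → (∀ k ∈ R, f k R ≤ n * ε) →
      ∃ S : Set ℕ, S.Infinite ∧ ∀ k ∈ S, f k (S \ {k}) < ε := by
    intro n
    induction n with
    | zero =>
      intro R hR hle
      refine ⟨R, hR, fun k hk => ?_⟩
      have := hle k hk
      push_cast at this
      linarith [hmono k (R \ {k}) R sdiff_subset]
    | succ n ih =>
      intro R hR hle
      let e := hR.natEmbedding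
      let Rp : ℕ → Set ℕ := fun p => range fun q => (e (Nat.pair p q) : ℕ)
      have hinj : ∀ p q p' q', (e (Nat.pair p q) : ℕ) = e (Nat.pair p' q') → p = p' ∧ q = q' :=
        fun p q p' q' h => Nat.pair_eq_pair.1 (e.injective (Subtype.ext h))
      have hRp : ∀ p, (Rp p).Infinite := fun p =>
        infinite_range_of_injective fun q q' h => (hinj p q p q' h).2
      have hRpR : ∀ p, Rp p ⊆ R := by
        rintro p _ ⟨q, rfl⟩
        exact (e (Nat.pair p q)).2
      by_contra! hcon
      choose k hk hkε using fun p => hcon (Rp p) (hRp p)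
      have hkeq : ∀ p p', k p ∈ Rp p' → p = p' := fun p p' h => by
        obtain ⟨q, hq⟩ := hk p
        obtain ⟨q', hq'⟩ := h
        exact (hinj p q p' q' (hq.trans hq'.symm)).1
      have hkinj : Function.Injective k := fun p p' h => hkeq p p' (h ▸ hk p')
      obtain ⟨S, hS, hlt⟩ := ih (range k) (infinite_range_of_injective hkinj) (by
        rintro _ ⟨p, rfl⟩
        have hdisj : Disjoint (range k) (Rp p \ {k p}) := by
          rw [Set.disjoint_left]
          rintro _ ⟨p', rfl⟩ ⟨h1, h2⟩
          exact h2 (by rw [hkeq p' p h1]; rfl)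
        have h1 := hadd (k p) _ _ hdisj
        have h2 := hmono (k p) (range k ∪ Rp p \ {k p}) R
          (union_subset (range_subset_iff.2 fun p => hRpR p (hk p))
            (sdiff_subset.trans (hRpR p)))
        have h3 := hle (k p) (hRpR p (hk p))
        push_cast at h3
        linarith [hkε p])
      obtain ⟨k, hk, hle⟩ := hcon S hS
      exact absurd (hlt k hk) hle.not_gt
  obtain ⟨n, hn⟩ := exists_nat_ge (b / ε)
  refine key n univ infinite_univ fun k _ => (hb k).trans ?_
  rwa [div_le_iff₀ hε] at hn

/-- If finitely additive measures on `𝒫(ℕ)` converge on every set, then their values on the diagonal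
singletons are not bounded away from zero. -/
lemma exists_singleton_lt_of_tendsto (h0 : ∀ k S, 0 ≤ f k S)
    (hadd : ∀ k S T, Disjoint S T → f k (S ∪ T) = f k S + f k T) {b : ℝ}
    (hb : ∀ k, f k univ ≤ b) (hlim : ∀ S, ∃ a, Tendsto (fun k => f k S) atTop (𝓝 a))
    {c : ℝ} (hc : 0 < c) : ∃ k, f k {k} < c := by
  by_contra! hcon
  have hmono : ∀ k S T, S ⊆ T → f k S ≤ f k T := fun k S T h => by
    have := hadd k S (T \ S) disjoint_sdiff_right
    rw [Set.union_sdiff_cancel h] at this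
    linarith [h0 k (T \ S)]
  obtain ⟨S, hS, hlt⟩ := exists_infinite_forall_diff_singleton_lt h0 hadd hb (half_pos hc)
  -- On one half of `S`, the values at that half are at least `c` for indices in it, and at most
  -- `c / 2` for indices in the other half.
  let e := hS.natEmbedding
  have hinj : ∀ i j, (e i : ℕ) = e j → i = j := fun i j h => e.injective (Subtype.ext h)
  let S₁ : Set ℕ := range fun i => (e (2 * i) : ℕ)
  obtain ⟨a, ha⟩ := hlim S₁
  have hinj₁ : Function.Injective fun i => (e (2 * i) : ℕ) := fun i j h => by
    have := hinj _ _ h; omega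
  have hinj₂ : Function.Injective fun i => (e (2 * i + 1) : ℕ) := fun i j h => by
    have := hinj _ _ h; omega
  have h1 : c ≤ a := ge_of_tendsto' (ha.comp hinj₁.nat_tendsto_atTop) fun i =>
    (hcon _).trans (hmono _ _ _ (singleton_subset_iff.2 ⟨i, rfl⟩))
  have h2 : a ≤ c / 2 := le_of_tendsto' (ha.comp hinj₂.nat_tendsto_atTop) fun i => by
    refine (hmono _ _ _ ?_).trans (hlt _ (e (2 * i + 1)).2).le
    rintro _ ⟨j, rfl⟩
    refine ⟨(e (2 * j)).2, fun h => ?_⟩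
    have := hinj _ _ h
    omega
  linarith

end Rosenthal

/-! ### Clopen sets of the Stone space -/

namespace StonePoint

variable {𝔹 : BooleanSubalgebra (Set ℕ)} {A C : Set ℕ}

lemma mem_hat {u : StonePoint 𝔹} : u ∈ hat 𝔹 A ↔ A ∈ u.sets := Iff.rfl

lemma hat_mono (hC : C ∈ 𝔹) (h : A ⊆ C) : hat 𝔹 A ⊆ hat 𝔹 C :=
  fun u hu => u.superset_mem A hu C hC h

lemma hat_empty : hat 𝔹 ∅ = ∅ := by
  ext u
  simpa [mem_hat] using u.empty_notMem

lemma hat_inter (hA : A ∈ 𝔹) (hC : C ∈ 𝔹) : hat 𝔹 (A ∩ C) = hat 𝔹 A ∩ hat 𝔹 C :=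
  Subset.antisymm (subset_inter (hat_mono hA inter_subset_left) (hat_mono hC inter_subset_right))
    fun u hu => u.inter_mem A hu.1 C hu.2

lemma hat_compl (hA : A ∈ 𝔹) : hat 𝔹 Aᶜ = (hat 𝔹 A)ᶜ := by
  ext u
  refine ⟨fun h h' => u.empty_notMem ?_, fun h => (u.mem_or_compl_mem A hA).resolve_left h⟩
  simpa using u.inter_mem A h' Aᶜ h

lemma hat_diff (hA : A ∈ 𝔹) (hC : C ∈ 𝔹) : hat 𝔹 (A \ C) = hat 𝔹 A \ hat 𝔹 C := by
  rw [Set.sdiff_eq, hat_inter hA (𝔹.compl_mem hC), hat_compl hC, Set.sdiff_eq]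

lemma hat_union (hA : A ∈ 𝔹) (hC : C ∈ 𝔹) : hat 𝔹 (A ∪ C) = hat 𝔹 A ∪ hat 𝔹 C := by
  rw [← compl_inj_iff, ← hat_compl (A := A ∪ C) (𝔹.sup_mem hA hC), Set.compl_union, Set.compl_union,
    hat_inter (𝔹.compl_mem hA) (𝔹.compl_mem hC), hat_compl hA, hat_compl hC]

lemma disjoint_hat (hA : A ∈ 𝔹) (hC : C ∈ 𝔹) (h : Disjoint A C) :
    Disjoint (hat 𝔹 A) (hat 𝔹 C) := by
  rw [disjoint_iff_inter_eq_empty, ← hat_inter hA hC, h.inter_eq, hat_empty]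

lemma isOpen_hat (hA : A ∈ 𝔹) : IsOpen (hat 𝔹 A) :=
  TopologicalSpace.isOpen_generateFrom_of_mem ⟨A, hA, rfl⟩

lemma isClopen_hat (hA : A ∈ 𝔹) : IsClopen (hat 𝔹 A) := by
  refine ⟨⟨?_⟩, isOpen_hat hA⟩
  rw [← hat_compl hA]
  exact isOpen_hat (𝔹.compl_mem hA)

lemma exists_hat_subset {O : Set (StonePoint 𝔹)} (hO : IsOpen O) {u : StonePoint 𝔹} (hu : u ∈ O) :
    ∃ A ∈ 𝔹, u ∈ hat 𝔹 A ∧ hat 𝔹 A ⊆ O := by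
  induction hO with
  | basic s hs =>
    obtain ⟨A, hA, rfl⟩ := hs
    exact ⟨A, hA, hu, Subset.rfl⟩
  | univ => exact ⟨Set.univ, 𝔹.top_mem, u.univ_mem, subset_univ _⟩
  | inter s t _ _ hs ht =>
    obtain ⟨A, hA, hA1, hA2⟩ := hs hu.1
    obtain ⟨C, hC, hC1, hC2⟩ := ht hu.2
    refine ⟨A ∩ C, 𝔹.inf_mem hA hC, u.inter_mem A hA1 C hC1, ?_⟩
    rw [hat_inter hA hC]
    exact inter_subset_inter hA2 hC2
  | sUnion S _ ih =>
    obtain ⟨s, hs, hus⟩ := hu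
    obtain ⟨A, hA, hA1, hA2⟩ := ih s hs hus
    exact ⟨A, hA, hA1, hA2.trans (subset_sUnion_of_mem hs)⟩

lemma exists_subset_hat_subset {G O : Set (StonePoint 𝔹)} (hG : IsCompact G) (hO : IsOpen O)
    (hGO : G ⊆ O) : ∃ A ∈ 𝔹, G ⊆ hat 𝔹 A ∧ hat 𝔹 A ⊆ O := by
  refine hG.induction_on (p := fun s => ∃ A ∈ 𝔹, s ⊆ hat 𝔹 A ∧ hat 𝔹 A ⊆ O) ?_ ?_ ?_ ?_
  · exact ⟨∅, 𝔹.bot_mem, empty_subset _, by simp [hat_empty]⟩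
  · rintro s t hst ⟨A, hA, h1, h2⟩
    exact ⟨A, hA, hst.trans h1, h2⟩
  · rintro s t ⟨A, hA, h1, h2⟩ ⟨C, hC, h3, h4⟩
    refine ⟨A ∪ C, 𝔹.sup_mem hA hC, ?_⟩
    rw [hat_union hA hC]
    exact ⟨union_subset_union h1 h3, union_subset h2 h4⟩
  · intro x hx
    obtain ⟨A, hA, h1, h2⟩ := exists_hat_subset hO (hGO hx)
    exact ⟨hat 𝔹 A, mem_nhdsWithin_of_mem_nhds ((isOpen_hat hA).mem_nhds h1), A, hA, Subset.rfl, h2⟩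

instance : T2Space (StonePoint 𝔹) := by
  refine ⟨fun u v huv => ?_⟩
  have : ∃ A ∈ 𝔹, A ∈ u.sets ∧ A ∉ v.sets := by
    by_contra! h
    refine huv (StonePoint.ext (Subset.antisymm (fun A hA => h A (u.sets_subset A hA) hA)
      fun A hA => ?_))
    by_contra hAu
    have hA𝔹 := v.sets_subset A hA
    have := h Aᶜ (𝔹.compl_mem hA𝔹) ((u.mem_or_compl_mem A hA𝔹).resolve_left hAu)
    exact v.empty_notMem (by simpa using v.inter_mem A hA _ this)
  obtain ⟨A, hA, hu, hv⟩ := this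
  refine ⟨hat 𝔹 A, hat 𝔹 Aᶜ, isOpen_hat hA, isOpen_hat (𝔹.compl_mem hA), hu,
    (v.mem_or_compl_mem A hA).resolve_left hv, disjoint_hat hA (𝔹.compl_mem hA)
      disjoint_compl_right⟩

lemma tendsto_measureReal_hat {ν : ℕ → Measure (StonePoint 𝔹)} {ν' : Measure (StonePoint 𝔹)}
    (hlim : ∀ f : C(StonePoint 𝔹, ℝ),
      Tendsto (fun n => ∫ x, f x ∂(ν n)) atTop (𝓝 (∫ x, f x ∂ν'))) (hA : A ∈ 𝔹) :
    Tendsto (fun n => (ν n).real (hat 𝔹 A)) atTop (𝓝 (ν'.real (hat 𝔹 A))) := by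
  have := hlim ⟨(hat 𝔹 A).indicator 1, (continuous_const).indicator
    fun a ha => by simp [(isClopen_hat hA).frontier_eq] at ha⟩
  simpa [integral_indicator_one (isOpen_hat hA).measurableSet] using this

lemma exists_finite_subset_hat {ν : Measure (StonePoint 𝔹)} [IsFiniteMeasure ν]
    (h : IsNonAtomic ν) {T : Set (StonePoint 𝔹)} (hT : T.Finite) {δ : ℝ} (hδ : 0 < δ) :
    ∃ D ∈ 𝔹, T ⊆ hat 𝔹 D ∧ ν.real (hat 𝔹 D) < δ := by
  induction T, hT using Set.Finite.induction_on generalizing δ with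
  | empty => exact ⟨∅, 𝔹.bot_mem, empty_subset _, by simpa [hat_empty]⟩
  | @insert u T _ _ ih =>
    obtain ⟨D, hD, hTD, hν⟩ := ih (half_pos hδ)
    obtain ⟨k, A, hA, -, hU, hlt⟩ := h (ENNReal.ofReal (δ / 2)) (by simpa using hδ)
    have : ∃ i, u ∈ hat 𝔹 (A i) := by
      by_contra! hcon
      have hmem : ∀ s : Finset (Fin k), (⋂ i ∈ s, (A i)ᶜ) ∈ u.sets := fun s => by
        induction s using Finset.induction_on with
        | empty => simpa using u.univ_mem
        | insert i s _ ih =>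
          rw [Finset.set_biInter_insert]
          exact u.inter_mem _ ((u.mem_or_compl_mem _ (hA i)).resolve_left (hcon i)) _ ih
      have := hmem Finset.univ
      simp only [Finset.mem_univ, iUnion_true, ← compl_iUnion, hU, compl_univ] at this
      exact u.empty_notMem this
    obtain ⟨i, hi⟩ := this
    refine ⟨A i ∪ D, 𝔹.sup_mem (hA i) hD, ?_, ?_⟩
    · rw [hat_union (hA i) hD]
      exact insert_subset (Or.inl hi) (hTD.trans subset_union_right)
    · rw [hat_union (hA i) hD]
      have h1 : ν.real (hat 𝔹 (A i)) < δ / 2 :=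
        ENNReal.toReal_lt_of_lt_ofReal (hlt i)
      linarith [measureReal_union_le (μ := ν) (hat 𝔹 (A i)) (hat 𝔹 D)]

end StonePoint

/-! ### Limits of measures that are atomic on a closed set -/

lemma MeasureTheory.Measure.exists_finite_subset_measureReal_diff_lt {X : Type*}
    [MeasurableSpace X] [MeasurableSingletonClass X] {ν : Measure X} [IsFiniteMeasure ν]
    {G S : Set X} (hG : MeasurableSet G) (hS : S.Countable) (h : ν (G \ S) = 0) {η : ℝ}
    (hη : 0 < η) : ∃ T : Set X, T.Finite ∧ ν.real (G \ T) < η := by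
  rcases S.eq_empty_or_nonempty with rfl | hne
  · exact ⟨∅, finite_empty, by
      rw [Measure.real, h]
      simpa using hη⟩
  obtain ⟨s, rfl⟩ := hS.exists_eq_range hne
  have hfin : ∀ k, (s '' Iio k).Finite := fun k => (finite_Iio k).image s
  have hanti : Antitone fun k => G \ s '' Iio k := fun a b hab =>
    sdiff_subset_sdiff_right (image_mono (Iio_subset_Iio hab))
  have hlim := tendsto_measure_iInter_atTop (μ := ν)
    (fun k => (hG.diff (hfin k).measurableSet).nullMeasurableSet) hanti ⟨0, measure_ne_top _ _⟩
  have hzero : ν (⋂ k, G \ s '' Iio k) = 0 := by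
    refine measure_mono_null (fun x hx => ?_) h
    rw [mem_iInter] at hx
    refine ⟨(hx 0).1, ?_⟩
    rintro ⟨k, rfl⟩
    exact (hx (k + 1)).2 ⟨k, k.lt_succ_self, rfl⟩
  rw [hzero] at hlim
  have := (ENNReal.tendsto_toReal_zero_iff fun _ => measure_ne_top _ _).2 hlim
  obtain ⟨k, hk⟩ := (this.eventually_lt_const hη).exists
  exact ⟨_, hfin k, hk⟩

namespace StonePoint

variable {𝔹 : BooleanSubalgebra (Set ℕ)} {ν : ℕ → Measure (StonePoint 𝔹)}
  {ν' : Measure (StonePoint 𝔹)} [∀ n, IsProbabilityMeasure (ν n)] [IsProbabilityMeasure ν']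
  {A : ℕ → Set ℕ}

/-- One step of a gliding hump: far out in the sequence there is a measure with a substantial part
of its mass on a set which avoids a given set `D`, lies within a given `A k` and is nearly null for
the limit measure. -/
lemma exists_hump
    (hlim : ∀ C ∈ 𝔹, Tendsto (fun n => (ν n).real (hat 𝔹 C)) atTop (𝓝 (ν'.real (hat 𝔹 C))))
    (hna : IsNonAtomic ν') (hA : ∀ k, A k ∈ 𝔹) (hanti : Antitone A)
    (hatom : ∀ n, ∃ S : Set (StonePoint 𝔹), S.Countable ∧ ν n ((⋂ k, hat 𝔹 (A k)) \ S) = 0)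
    {r : ℝ} (hr : ν'.real (⋂ k, hat 𝔹 (A k)) = r) (k N : ℕ) {D : Set ℕ} (hD : D ∈ 𝔹)
    (hDr : ν'.real (hat 𝔹 D) < r / 2) :
    ∃ n > N, ∃ C ∈ 𝔹, C ⊆ A k ∧ Disjoint C D ∧ r / 4 ≤ (ν n).real (hat 𝔹 C) ∧
      ν'.real (hat 𝔹 (D ∪ C)) < r / 2 := by
  have hmeas : ∀ {C}, C ∈ 𝔹 → MeasurableSet (hat 𝔹 C) := fun hC => (isOpen_hat hC).measurableSet
  set G := ⋂ k, hat 𝔹 (A k) with hGdef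
  have hGm : MeasurableSet G := .iInter fun k => hmeas (hA k)
  have hGA : ∀ k, G ⊆ hat 𝔹 (A k) := fun k => iInter_subset _ k
  have hcont : ∀ (ρ : Measure (StonePoint 𝔹)) [IsProbabilityMeasure ρ],
      Tendsto (fun k => ρ.real (hat 𝔹 (A k))) atTop (𝓝 (ρ.real G)) := fun ρ _ =>
    (ENNReal.tendsto_toReal (measure_ne_top _ _)).comp (tendsto_measure_iInter_atTop
      (fun k => (hmeas (hA k)).nullMeasurableSet) (fun a b hab => hat_mono (hA a) (hanti hab))
      ⟨0, measure_ne_top _ _⟩)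
  set δ := r / 2 - ν'.real (hat 𝔹 D) with hδ
  have hδ0 : 0 < δ := by linarith
  have hr0 : 0 < r := by linarith [measureReal_nonneg (μ := ν') (s := hat 𝔹 D)]
  obtain ⟨i, hi, hik⟩ := (((hcont ν').eventually_lt_const
    (show ν'.real G < r + δ / 2 by linarith)).and (eventually_ge_atTop k)).exists
  have hC0 : A i \ D ∈ 𝔹 := 𝔹.sdiff_mem (hA i) hD
  have hC0r : r / 2 < ν'.real (hat 𝔹 (A i \ D)) := by
    have h1 : ν'.real G ≤ ν'.real (hat 𝔹 (A i)) := measureReal_mono (hGA i)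
    have h2 := le_measureReal_sdiff (μ := ν') (s₁ := hat 𝔹 (A i)) (s₂ := hat 𝔹 D)
    rw [hat_diff (hA i) hD]
    linarith
  obtain ⟨n, hn, hnN⟩ := (((hlim _ hC0).eventually_const_lt hC0r).and
    (eventually_gt_atTop N)).exists
  obtain ⟨S, hS, hSn⟩ := hatom n
  obtain ⟨T, hT, hTn⟩ := Measure.exists_finite_subset_measureReal_diff_lt (ν := ν n) hGm hS hSn
    (show 0 < r / 8 by linarith)
  obtain ⟨E, hE, hTE, hEδ⟩ := exists_finite_subset_hat hna hT (half_pos hδ0)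
  obtain ⟨i', hi', hii'⟩ := (((hcont (ν n)).eventually_lt_const
    (show (ν n).real G < (ν n).real G + r / 8 by linarith)).and (eventually_ge_atTop i)).exists
  have hR : A i' \ E ∈ 𝔹 := 𝔹.sdiff_mem (hA i') hE
  have hC : (A i \ D) \ (A i' \ E) ∈ 𝔹 := 𝔹.sdiff_mem hC0 hR
  refine ⟨n, hnN, _, hC, (sdiff_subset.trans sdiff_subset).trans (hanti hik),
    disjoint_sdiff_left.mono_left sdiff_subset, ?_, ?_⟩
  -- The removed part `A i' \ E` is close to `G` without the atoms in `T`, hence small for `ν n`.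
  · have h1 : (ν n).real (hat 𝔹 (A i' \ E)) ≤
        (ν n).real (hat 𝔹 (A i') \ G) + (ν n).real (G \ T) := by
      refine (measureReal_mono ?_).trans (measureReal_union_le _ _)
      rw [hat_diff (hA i') hE]
      rintro x ⟨hx, hxE⟩
      by_cases hxG : x ∈ G
      · exact Or.inr ⟨hxG, fun hxT => hxE (hTE hxT)⟩
      · exact Or.inl ⟨hx, hxG⟩
    rw [measureReal_sdiff (hGA i') hGm] at h1
    have h2 := le_measureReal_sdiff (μ := ν n) (s₁ := hat 𝔹 (A i \ D)) (s₂ := hat 𝔹 (A i' \ E))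
    rw [hat_diff hC0 hR]
    linarith
  -- What remains of `A i` is contained in `A i \ A i'` and `E`, both small for the limit measure.
  · have h1 : ν'.real (hat 𝔹 (A i) \ hat 𝔹 (A i')) < δ / 2 := by
      rw [measureReal_sdiff (hat_mono (hA i) (hanti hii')) (hmeas (hA i'))]
      have : ν'.real G ≤ ν'.real (hat 𝔹 (A i')) := measureReal_mono (hGA i')
      linarith
    have h2 : ν'.real (hat 𝔹 ((A i \ D) \ (A i' \ E))) ≤
        ν'.real (hat 𝔹 (A i) \ hat 𝔹 (A i')) + ν'.real (hat 𝔹 E) := by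
      refine (measureReal_mono ?_).trans (measureReal_union_le _ _)
      rw [hat_diff hC0 hR, hat_diff (hA i) hD, hat_diff (hA i') hE]
      rintro x ⟨hx, hx'⟩
      by_cases hxE : x ∈ hat 𝔹 E
      · exact Or.inr hxE
      · exact Or.inl ⟨hx.1, fun h => hx' ⟨h, hxE⟩⟩
    rw [hat_union hD hC]
    linarith [measureReal_union_le (μ := ν') (hat 𝔹 D) (hat 𝔹 ((A i \ D) \ (A i' \ E)))]

/-- A non-atomic limit of measures, each of which is carried by countably many points on the closed
set `⋂ k, hat (A k)`, vanishes on that set if the algebra contains all unions of sequences of its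
members dominated by `A`. -/
lemma measure_iInter_hat_eq_zero
    (hlim : ∀ C ∈ 𝔹, Tendsto (fun n => (ν n).real (hat 𝔹 C)) atTop (𝓝 (ν'.real (hat 𝔹 C))))
    (hna : IsNonAtomic ν') (hA : ∀ k, A k ∈ 𝔹) (hanti : Antitone A)
    (hunion : ∀ C : ℕ → Set ℕ, (∀ k, C k ∈ 𝔹) → (∀ k, C k ⊆ A k) → (⋃ k, C k) ∈ 𝔹)
    (hatom : ∀ n, ∃ S : Set (StonePoint 𝔹), S.Countable ∧ ν n ((⋂ k, hat 𝔹 (A k)) \ S) = 0) :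
    ν' (⋂ k, hat 𝔹 (A k)) = 0 := by
  by_contra hne
  obtain ⟨r, hr⟩ : ∃ r, ν'.real (⋂ k, hat 𝔹 (A k)) = r := ⟨_, rfl⟩
  have hr0 : 0 < r := by
    rw [← hr]
    exact ENNReal.toReal_pos hne (measure_ne_top _ _)
  -- The state consists of the union of the sets chosen so far and the last index used.
  let σ := {p : Set ℕ × ℕ // p.1 ∈ 𝔹 ∧ ν'.real (hat 𝔹 p.1) < r / 2}
  have step : ∀ (k : ℕ) (s : σ), ∃ q : σ × Set ℕ, q.2 ∈ 𝔹 ∧ q.2 ⊆ A k ∧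
      Disjoint q.2 s.1.1 ∧ q.1.1.1 = s.1.1 ∪ q.2 ∧ s.1.2 < q.1.1.2 ∧
      r / 4 ≤ (ν q.1.1.2).real (hat 𝔹 q.2) := by
    rintro k ⟨⟨D, N⟩, hD, hDr⟩
    obtain ⟨n, hn, C, hC, h1, h2, h3, h4⟩ := exists_hump hlim hna hA hanti hatom hr k N hD hDr
    exact ⟨⟨⟨⟨D ∪ C, n⟩, 𝔹.sup_mem hD hC, h4⟩, C⟩, hC, h1, h2, rfl, hn, h3⟩
  choose F hF𝔹 hFA hFd hFu hFn hFr using step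
  let s : ℕ → σ := fun k => Nat.rec ⟨⟨∅, 0⟩, 𝔹.bot_mem, by
    rw [hat_empty, measureReal_empty]
    exact half_pos hr0⟩ (fun k t => (F k t).1) k
  let C : ℕ → Set ℕ := fun k => (F k (s k)).2
  let n : ℕ → ℕ := fun k => (s (k + 1)).1.2
  have hC𝔹 : ∀ k, C k ∈ 𝔹 := fun k => hF𝔹 k (s k)
  have hn : StrictMono n := strictMono_nat_of_lt_succ fun k => hFn (k + 1) (s (k + 1))
  have hsu : ∀ k, (s (k + 1)).1.1 = (s k).1.1 ∪ C k := fun k => hFu k (s k)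
  have hsmono : Monotone fun k => (s k).1.1 := monotone_nat_of_le_succ fun k => by
    rw [hsu]
    exact subset_union_left
  have hCd : Pairwise fun i j => Disjoint (C i) (C j) := by
    have : ∀ i j, i < j → Disjoint (C i) (C j) := fun i j hij => by
      refine ((hFd j (s j)).mono_right ?_).symm
      refine Subset.trans ?_ (hsmono (Nat.succ_le_of_lt hij))
      simp only [Nat.succ_eq_add_one, hsu]
      exact subset_union_right
    intro i j hij
    rcases lt_or_gt_of_ne hij with h | h
    · exact this i j h
    · exact (this j i h).symm
  have hU : ∀ S : Set ℕ, (⋃ i ∈ S, C i) ∈ 𝔹 := fun S => by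
    refine hunion (fun i => ⋃ _ : i ∈ S, C i) (fun k => ?_) fun k => ?_
    · by_cases hk : k ∈ S
      · simpa [hk] using hC𝔹 k
      · simpa [hk] using 𝔹.bot_mem
    · exact iUnion_subset fun _ => hFA k (s k)
  obtain ⟨k, hk⟩ := exists_singleton_lt_of_tendsto
    (f := fun k S => (ν (n k)).real (hat 𝔹 (⋃ i ∈ S, C i))) (b := 1) (c := r / 4)
    (fun _ _ => measureReal_nonneg)
    (fun k S T hST => by
      have hd : Disjoint (⋃ i ∈ S, C i) (⋃ i ∈ T, C i) := by
        simp only [disjoint_iUnion_left, disjoint_iUnion_right]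
        exact fun i hi j hj => hCd fun h => (Set.disjoint_left.1 hST) hj (h ▸ hi)
      rw [Set.biUnion_union, hat_union (hU S) (hU T), measureReal_union
        (disjoint_hat (hU S) (hU T) hd) (isOpen_hat (hU T)).measurableSet])
    (fun _ => measureReal_le_one)
    (fun S => ⟨_, (hlim _ (hU S)).comp hn.tendsto_atTop⟩) (by linarith)
  rw [Set.biUnion_singleton] at hk
  exact absurd (hFr k (s k)) hk.not_ge

end StonePoint

/-! ### Closed sets of measure zero off the pieces -/

open StonePoint in
/-- A compact set disjoint from the pieces and null for the canonical measure has arbitrarily small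
clopen neighbourhoods, uniformly along the sequence `m`, which avoid any finitely many pieces. -/
lemma Stage.IsAsymptotic.exists_neighbourhoods {P : Stage} {L : BooleanSubalgebra (Set ℕ)}
    {m : ℕ → Set ℕ → ℝ} (h : P.IsAsymptotic L m) {μ : Measure P.K} (hμ : P.IsCanonicalMeasure μ)
    {G : Set P.K} (hG : IsCompact G) (hGU : G ⊆ P.brickUnionᶜ) (hμG : μ G = 0) :
    ∃ A : ℕ → Set ℕ, (∀ k, A k ∈ P.alg) ∧ Antitone A ∧ (∀ k, G ⊆ hat P.alg (A k)) ∧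
      (∀ k, ∀ j < k, Disjoint (A k) (P.brick j)) ∧ (∀ k j, m j (A k) ≤ (1 / 2) ^ k) ∧
      ∀ k, μ (hat P.alg (A k)) ≤ ENNReal.ofReal ((1 / 2) ^ k) := by
  have := hμ.1
  have key : ∀ k : ℕ, ∃ A ∈ P.alg, G ⊆ hat P.alg A ∧ (∀ j < k, Disjoint A (P.brick j)) ∧
      (∀ j, m j A ≤ (1 / 2) ^ k) ∧ μ (hat P.alg A) ≤ ENNReal.ofReal ((1 / 2) ^ k) := by
    intro k
    obtain ⟨O, hGO, hO, hμO⟩ := G.exists_isOpen_lt_of_lt (μ := μ) (ENNReal.ofReal ((1 / 2) ^ k))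
      (by rw [hμG]; simp)
    obtain ⟨A, hA, hGA, hAO⟩ := exists_subset_hat_subset hG hO hGO
    have hμA := (measure_mono hAO).trans_lt hμO
    have hlt : P.meas A < (1 / 2) ^ k := by
      rw [hμ.2 A hA] at hμA
      exact (ENNReal.ofReal_lt_ofReal_iff (by positivity)).1 hμA
    obtain ⟨J, hJ⟩ := eventually_atTop.1 ((h.tendsto_meas A hA).eventually_lt_const hlt)
    have hV : ∀ N, (⋃ j < N, P.brick j) ∈ P.alg := fun N => by
      induction N with
      | zero => simpa using P.alg.bot_mem
      | succ N ih =>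
        rw [Set.biUnion_lt_succ]
        exact P.alg.sup_mem ih (h.brick_mem_alg N)
    have hGV : ∀ N, Disjoint G (hat P.alg (⋃ j < N, P.brick j)) := fun N => by
      induction N with
      | zero => simp [hat_empty]
      | succ N ih =>
        rw [Set.biUnion_lt_succ, hat_union (hV N) (h.brick_mem_alg N), disjoint_union_right]
        refine ⟨ih, Set.disjoint_left.2 fun x hx hx' => hGU hx ?_⟩
        exact mem_iUnion.2 ⟨N, hx'⟩
    -- Removing the pieces with indices below `max J k` makes the measures of index below `J` vanish.
    set V := ⋃ j < max J k, P.brick j with hVdef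
    have hVd : ∀ j < max J k, Disjoint (A \ V) (P.brick j) := fun j hj =>
      disjoint_sdiff_left.mono_right (subset_biUnion_of_mem (u := fun j => P.brick j) hj)
    have hAV : A \ V ∈ P.alg := P.alg.sdiff_mem hA (hV _)
    refine ⟨A \ V, hAV, ?_, fun j hj => hVd j (lt_max_of_lt_right hj), fun j => ?_, ?_⟩
    · rw [hat_diff hA (hV _)]
      exact subset_sdiff.2 ⟨hGA, hGV _⟩
    · rcases lt_or_ge j J with hj | hj
      · rw [h.eq_zero j _ (h.le hAV) fun i hi => hVd i (lt_max_of_lt_left (hi.trans_lt hj))]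
        positivity
      · exact ((h.isLift.content j).mono (h.le hAV) (h.le hA) sdiff_subset).trans (hJ j hj).le
    · exact (measure_mono (hat_mono hA sdiff_subset)).trans hμA.le
  choose A' hA' hG' hd' hm' hμ' using key
  let A : ℕ → Set ℕ := fun k => Nat.rec (A' 0) (fun k s => s ∩ A' (k + 1)) k
  have hA : ∀ k, A k ∈ P.alg := fun k => by
    induction k with
    | zero => exact hA' 0
    | succ k ih => exact P.alg.inf_mem ih (hA' (k + 1))
  have hsub : ∀ k, A k ⊆ A' k := fun k => by
    cases k with
    | zero => exact Subset.rfl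
    | succ k => exact inter_subset_right
  refine ⟨A, hA, antitone_nat_of_succ_le fun k => inter_subset_left, fun k => ?_,
    fun k j hj => (hd' k j hj).mono_left (hsub k), fun k j => ?_, fun k => ?_⟩
  · induction k with
    | zero => exact hG' 0
    | succ k ih =>
      change G ⊆ hat P.alg (A k ∩ A' (k + 1))
      rw [hat_inter (hA k) (hA' _)]
      exact subset_inter ih (hG' _)
  · exact ((h.isLift.content j).mono (h.le (hA k)) (h.le (hA' k)) (hsub k)).trans (hm' k j)
  · exact (measure_mono (hat_mono (hA' k) (hsub k))).trans (hμ' k)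

/-- On a null set off the pieces, an almost absolutely continuous measure is carried by countably
many points. -/
lemma Stage.AlmostAbsolutelyContinuous.exists_countable {P : Stage} {ν μ : Measure P.K}
    [IsFiniteMeasure ν] (h : P.AlmostAbsolutelyContinuous ν μ) {G : Set P.K}
    (hG : MeasurableSet G) (hGU : G ⊆ P.brickUnionᶜ) (hμG : μ G = 0) :
    ∃ S : Set P.K, S.Countable ∧ ν (G \ S) = 0 := by
  refine ⟨{x | (ν.restrict P.brickUnionᶜ) {x} ≠ 0}, ?_, ?_⟩
  · have := Measure.countable_meas_pos_of_disjoint_iUnion (μ := ν.restrict P.brickUnionᶜ)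
      (As := fun x : P.K => {x}) (fun x => measurableSet_singleton x)
      (fun x y hxy => disjoint_singleton.2 hxy)
    simpa [pos_iff_ne_zero] using this
  · have h0 := h hμG
    rw [nonAtomicPart, Measure.restrict_apply hG] at h0
    refine measure_mono_null (fun x hx => ?_)
      (le_antisymm ((Measure.le_restrict_apply _ _).trans h0.le) zero_le)
    exact ⟨⟨hx.1, not_not.1 hx.2⟩, hGU hx.1⟩

theorem theorem3p4
    (B : ℕ → Set ℕ) (hB : IsInfinitePartition B)
    (φ : MeasAlg → Set ℕ) (hφ : IsDensityLifting φ)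
    (α : Ordinal.{0}) (hα : 1 ≤ α) (hα' : α < ω₁)
    (P : Stage) (hP : IsStage B φ α P)
    (μ : Measure P.K) (hμ : P.IsCanonicalMeasure μ)
    (ν : ℕ → Measure P.K) (hν_prob : ∀ n, IsProbabilityMeasure (ν n))
    (hν_reg : ∀ n, (ν n).Regular)
    (hν : ∀ n, P.AlmostAbsolutelyContinuous (ν n) μ)
    (ν' : Measure P.K) (hν'_prob : IsProbabilityMeasure ν') (hν'_reg : ν'.Regular)
    (hν'_nonatomic : IsNonAtomic ν')
    (hlim : ∀ f : C(P.K, ℝ),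
      Tendsto (fun n => ∫ x, f x ∂(ν n)) atTop (𝓝 (∫ x, f x ∂ν'))) :
    P.AlmostAbsolutelyContinuous ν' μ := by
  obtain ⟨L, m, h⟩ := hP.exists_isAsymptotic hB hφ
  have hUm : MeasurableSet P.brickUnion :=
    .iUnion fun n => (StonePoint.isOpen_hat (h.brick_mem_alg n)).measurableSet
  refine Measure.AbsolutelyContinuous.mk fun s hs hμs => ?_
  refine le_antisymm ((Measure.restrict_le_self s).trans ?_) zero_le
  rw [Measure.restrict_apply hs]
  by_contra! hpos
  obtain ⟨G, hGs, hG, hνG⟩ := (hs.inter hUm.compl).exists_lt_isCompact_of_ne_top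
    (measure_ne_top ν' _) hpos
  obtain ⟨A, hA, hanti, hGA, hAd, hAm, hAμ⟩ := h.exists_neighbourhoods hμ hG
    (hGs.trans inter_subset_right) (measure_mono_null (hGs.trans inter_subset_left) hμs)
  refine hνG.not_ge (le_of_le_of_eq (measure_mono (subset_iInter hGA)) ?_)
  have hnull : μ (⋂ k, StonePoint.hat P.alg (A k)) = 0 := by
    have hpow : Tendsto (fun k : ℕ => ENNReal.ofReal ((1 / 2) ^ k)) atTop (𝓝 0) := by
      simpa using ENNReal.tendsto_ofReal (tendsto_pow_atTop_nhds_zero_of_lt_one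
        (r := (1 / 2 : ℝ)) (by norm_num) (by norm_num))
    exact le_antisymm (ge_of_tendsto' hpow fun k =>
      (measure_mono (iInter_subset _ k)).trans (hAμ k)) zero_le
  have hoff : (⋂ k, StonePoint.hat P.alg (A k)) ⊆ P.brickUnionᶜ := fun x hx hx' => by
    obtain ⟨j, hj⟩ := mem_iUnion.1 hx'
    exact (StonePoint.disjoint_hat (hA (j + 1)) (h.brick_mem_alg j)
      (hAd (j + 1) j j.lt_succ_self)).le_bot ⟨mem_iInter.1 hx (j + 1), hj⟩
  refine StonePoint.measure_iInter_hat_eq_zero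
    (fun C hC => StonePoint.tendsto_measureReal_hat hlim hC) hν'_nonatomic hA hanti
    (fun C hC hCA => h.iUnion_mem hC (fun k j hj => (hAd k j hj).mono_left (hCA k))
      fun k j => ((h.isLift.content j).mono (h.le (hC k)) (h.le (hA k)) (hCA k)).trans (hAm k j))
    fun n => (hν n).exists_countable ?_ hoff hnull
  exact .iInter fun k => (StonePoint.isOpen_hat (hA k)).measurableSet
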